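/- Let $X$ be the space of complex sequences $c=(c_n)_{n\ge 0}$ such that $$\|c\|_X^2:=\sup_{n\ge 0}\frac{1}{n+1}\sum_{k=0}^{n}(k+1)^2|c_k|^2<\infty ,$$ and let $\ell^2_+$ denote the space of square-summable complex sequences indexed by the integers $n\ge 0$, with its usual norm $\|\cdot\|_2$. **Theorem 3.3 (Generalized Hilbert Inequality).** There is an absolute constant $B$ such that for every $c=(c_n)\in X$ and all $a=(a_n),\,b=(b_n)\in\ell^2_+$ the following double series converges and $$\sum_{n,m=0}^{\infty}|a_n|\,|b_m|\,|c_{n+m}|\le B\,\|c\|_X\,\|a\|_2\,\|b\|_2 .$$ In other words, for every $c\in X$ the Hankel-type bilinear form $(a,b)\mapsto\sum_{n,m=0}^\infty |c_{n+m}|\,a_n b_m$ is well defined (the series converges absolutely) and bounded on $\ell^2_+\times\ell^2_+$, with norm at most $B\|c\|_X$. The sequence $c_n=\frac1{n+1}$ belongs to $X$ and has $\|c\|_X=1$, and for it the inequality is Hilbert's classical inequality $$\sum_{n,m=0}^{\infty}\frac{|a_n|\,|b_m|}{n+m+1}\le B\,\|a\|_2\,\|b\|_2\qquad(a,b\in\ell^2_+).$$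 -/

import Mathlib

open scoped ENNReal

noncomputable section

namespace GenHilbert

/-- The Hilbert space of square-summable complex sequences indexed by the nonnegative integers. -/
abbrev EllTwo : Type := lp (fun _ : ℕ => ℂ) 2

/-- The quotient `(∑_{k=0}^n (k+1)^2 |c_k|^2) / (n+1)`. -/
def avg (c : ℕ → ℂ) (n : ℕ) : ℝ :=
  (∑ k ∈ Finset.range (n + 1), ((k : ℝ) + 1) ^ 2 * ‖c k‖ ^ 2) / ((n : ℝ) + 1)

/-- The space `X`: complex sequences for which the quotients `avg c n` are bounded in `n`. -/
def X : Set (ℕ → ℂ) := {c | BddAbove (Set.range (avg c))}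

/-- The norm of `X`: the square root of the supremum of the quotients `avg c n`. -/
def normX (c : ℕ → ℂ) : ℝ := √(⨆ n : ℕ, avg c n)

/-- The sequence `1, 1/2, 1/3, …`. -/
def harmonicSeq (n : ℕ) : ℂ := 1 / ((n : ℂ) + 1)

end GenHilbert

end

/-!
The matrix `|c_{n+m}|` satisfies the hypothesis of Schur's test with the weight
`w_n = (n+1)^{3/8}`: the rescaled row sums `∑_m |c_{n+m}| w_n / w_m` are at most `5 ‖c‖_X`.
By the Cauchy-Schwarz inequality such a row sum, squared, is at most the product of
`∑_m |c_{n+m}|² (n+m+1)^{1/2}` and `(n+1)^{3/4} ∑_m (m+1)^{-3/4} (n+m+1)^{-1/2}`.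
The growth condition on the partial sums of `(k+1)² |c_k|²` bounds the first factor by
`3 ‖c‖_X² (n+1)^{-1/2}`, through summation by parts (`sum_sq_mul_sqrt_le`), and the second factor
is at most `8 (n+1)^{1/2}` (`sum_inv_mul_inv_le`).
Both bounds are proved by telescoping, with powers of square roots and fourth roots in place
of integrals. Schur's test (`schur_sum_le`) on finite squares then gives absolute convergence
and the bound with `B = 5`, and the bilinear form is the sum of the double series.
-/

namespace GenHilbert

open Finset

/-! ### Schur's test on finite squares -/

/-- Schur's test for a symmetric nonnegative kernel: one bound on the rescaled row sums is
enough, as the rescaled column sums are the same numbers. -/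
lemma schur_sum_le {κ : ℕ → ℕ → ℝ} (hκ : ∀ n m, 0 ≤ κ n m) (hsymm : ∀ n m, κ n m = κ m n)
    {w : ℕ → ℝ} (hw : ∀ n, 0 < w n) {M : ℝ} (hM : 0 ≤ M) (N : ℕ)
    (hrow : ∀ n, ∑ m ∈ range N, κ n m * (w n / w m) ≤ M)
    (x y : ℕ → ℝ) {A B : ℝ} (hA : 0 ≤ A) (hB : 0 ≤ B)
    (hx : ∑ n ∈ range N, x n ^ 2 ≤ A ^ 2) (hy : ∑ n ∈ range N, y n ^ 2 ≤ B ^ 2) :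
    ∑ p ∈ range N ×ˢ range N, x p.1 * y p.2 * κ p.1 p.2 ≤ M * A * B := by
  have key : ∀ z : ℕ → ℝ, ∀ C : ℝ, ∑ n ∈ range N, z n ^ 2 ≤ C ^ 2 →
      ∑ n ∈ range N, ∑ m ∈ range N, z n ^ 2 * (κ n m * (w n / w m)) ≤ M * C ^ 2 := by
    intro z C hz
    calc _ ≤ ∑ n ∈ range N, z n ^ 2 * M := by
          refine sum_le_sum fun n _ => ?_
          rw [← mul_sum]
          exact mul_le_mul_of_nonneg_left (hrow n) (sq_nonneg _)
      _ = M * ∑ n ∈ range N, z n ^ 2 := by rw [← sum_mul, mul_comm]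
      _ ≤ _ := mul_le_mul_of_nonneg_left hz hM
  have hfac : ∀ n m, 0 ≤ κ n m * (w n / w m) := fun n m =>
    mul_nonneg (hκ n m) (div_pos (hw n) (hw m)).le
  have hcs := sum_sq_le_sum_mul_sum_of_sq_le_mul (range N ×ˢ range N)
    (r := fun p => x p.1 * y p.2 * κ p.1 p.2)
    (f := fun p => x p.1 ^ 2 * (κ p.1 p.2 * (w p.1 / w p.2)))
    (g := fun p => y p.2 ^ 2 * (κ p.2 p.1 * (w p.2 / w p.1)))
    (fun p _ => mul_nonneg (sq_nonneg _) (hfac _ _))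
    (fun p _ => mul_nonneg (sq_nonneg _) (hfac _ _))
    (fun p _ => by
      have h1 := (hw p.1).ne'
      have h2 := (hw p.2).ne'
      rw [hsymm p.2 p.1]
      apply le_of_eq
      field_simp)
  have h1 : ∑ p ∈ range N ×ˢ range N, x p.1 ^ 2 * (κ p.1 p.2 * (w p.1 / w p.2)) ≤ M * A ^ 2 := by
    rw [sum_product]; exact key x A hx
  have h2 : ∑ p ∈ range N ×ˢ range N, y p.2 ^ 2 * (κ p.2 p.1 * (w p.2 / w p.1)) ≤ M * B ^ 2 := by
    rw [sum_product_right]; exact key y B hy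
  refine abs_le_of_sq_le_sq' ?_ (by positivity) |>.2
  calc _ ≤ _ := hcs
    _ ≤ (M * A ^ 2) * (M * B ^ 2) :=
        mul_le_mul h1 h2 (sum_nonneg fun p _ => mul_nonneg (sq_nonneg _) (hfac _ _))
          (by positivity)
    _ = (M * A * B) ^ 2 := by ring

/-! ### Telescoping bounds for sums of powers -/

/-- The positive fourth root of `n + 1`. -/
noncomputable def fourthRoot (n : ℕ) : ℝ := √√((n : ℝ) + 1)

lemma fourthRoot_pos (n : ℕ) : 0 < fourthRoot n := by unfold fourthRoot; positivity

lemma fourthRoot_sq (n : ℕ) : fourthRoot n ^ 2 = √((n : ℝ) + 1) :=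
  Real.sq_sqrt (Real.sqrt_nonneg _)

lemma fourthRoot_pow_four (n : ℕ) : fourthRoot n ^ 4 = (n : ℝ) + 1 := by
  rw [show fourthRoot n ^ 4 = (fourthRoot n ^ 2) ^ 2 by ring, fourthRoot_sq,
    Real.sq_sqrt (by positivity)]

lemma fourthRoot_mono {m n : ℕ} (h : m ≤ n) : fourthRoot m ≤ fourthRoot n := by
  unfold fourthRoot; gcongr

/-- One telescoping step for `∑ (m+1)^{-3/4}`, where `u` and `v` are consecutive fourth roots. -/
lemma inv_cube_le {u v : ℝ} (hv : 0 ≤ v) (hvu : v ≤ u) (hu : 0 < u) (h : u ^ 4 = v ^ 4 + 1) :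
    1 / u ^ 3 ≤ 4 * (u - v) := by
  rw [div_le_iff₀ (by positivity)]
  have h1 : (u + v) * (u ^ 2 + v ^ 2) ≤ (2 * u) * (2 * u ^ 2) := by
    have : v ^ 2 ≤ u ^ 2 := by gcongr
    gcongr <;> linarith
  nlinarith [mul_le_mul_of_nonneg_left h1 (sub_nonneg.2 hvu)]

/-- One telescoping step for `∑ (m+1)^{-5/4}`, where `u` and `v` are consecutive fourth roots. -/
lemma inv_fifth_le {u v : ℝ} (hv : 0 < v) (hvu : v ≤ u) (h : u ^ 4 = v ^ 4 + 1) :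
    1 / u ^ 5 ≤ 4 * (1 / v - 1 / u) := by
  have hu : 0 < u := hv.trans_le hvu
  calc 1 / u ^ 5 = 1 / u ^ 3 * (1 / u ^ 2) := by field_simp
    _ ≤ 4 * (u - v) * (1 / (u * v)) := by
        have h2 : u * v ≤ u ^ 2 := by nlinarith
        have h3 : 0 ≤ u - v := sub_nonneg.2 hvu
        have := inv_cube_le hv.le hvu hu h
        gcongr
    _ = 4 * (1 / v - 1 / u) := by field_simp

lemma sum_inv_cube_le (N : ℕ) :
    ∑ m ∈ range (N + 1), 1 / fourthRoot m ^ 3 ≤ 4 * fourthRoot N := by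
  induction N with
  | zero => simp [fourthRoot]
  | succ N ih =>
    rw [sum_range_succ]
    have := inv_cube_le (fourthRoot_pos N).le (fourthRoot_mono N.le_succ) (fourthRoot_pos (N + 1))
      (by rw [fourthRoot_pow_four, fourthRoot_pow_four]; push_cast; ring)
    linarith

/-- The sum `∑_m (m+1)^{-3/4} (n+m+1)^{-1/2}` is at most `8 (n+1)^{-1/4}`. For `m ≤ n` the second
factor is replaced by `(n+1)^{-1/2}`, for `m > n` by `(m+1)^{-1/2}`. -/
lemma sum_inv_mul_inv_le (n N : ℕ) :
    ∑ m ∈ range N, 1 / fourthRoot m ^ 3 * (1 / fourthRoot (n + m) ^ 2) ≤ 8 / fourthRoot n := by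
  have hpos := fourthRoot_pos
  have hnn : ∀ m, 0 ≤ 1 / fourthRoot m ^ 3 * (1 / fourthRoot (n + m) ^ 2) := fun m => by
    have := hpos m
    have := hpos (n + m)
    positivity
  have hbase : ∑ m ∈ range (n + 1), 1 / fourthRoot m ^ 3 * (1 / fourthRoot (n + m) ^ 2)
      ≤ 4 / fourthRoot n := by
    have h0 := hpos n
    calc _ ≤ ∑ m ∈ range (n + 1), 1 / fourthRoot m ^ 3 * (1 / fourthRoot n ^ 2) := by
          refine sum_le_sum fun m _ => ?_
          have h1 := hpos m
          have h2 := fourthRoot_mono (Nat.le_add_right n m)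
          gcongr
      _ = (∑ m ∈ range (n + 1), 1 / fourthRoot m ^ 3) * (1 / fourthRoot n ^ 2) := by
          rw [sum_mul]
      _ ≤ 4 * fourthRoot n * (1 / fourthRoot n ^ 2) := by
          gcongr
          exact sum_inv_cube_le n
      _ = 4 / fourthRoot n := by field_simp
  have htail : ∀ j, ∑ m ∈ range (n + 1 + j), 1 / fourthRoot m ^ 3 * (1 / fourthRoot (n + m) ^ 2)
      ≤ 8 / fourthRoot n - 4 / fourthRoot (n + j) := by
    intro j
    induction j with
    | zero =>
      have : 8 / fourthRoot n - 4 / fourthRoot (n + 0) = 4 / fourthRoot n := by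
        rw [add_zero]; ring
      rw [this]; exact hbase
    | succ j ih =>
      rw [← add_assoc, sum_range_succ]
      have h1 := inv_fifth_le (hpos (n + j)) (fourthRoot_mono (Nat.le_add_right (n + j) 1))
        (by rw [fourthRoot_pow_four, fourthRoot_pow_four]; push_cast; ring)
      have h2 : 1 / fourthRoot (n + 1 + j) ^ 3 * (1 / fourthRoot (n + (n + 1 + j)) ^ 2)
          ≤ 1 / fourthRoot (n + j + 1) ^ 5 := by
        have h3 := hpos (n + j + 1)
        have h4 : fourthRoot (n + j + 1) ≤ fourthRoot (n + (n + 1 + j)) :=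
          fourthRoot_mono (by omega)
        rw [show n + 1 + j = n + j + 1 by omega] at h4 ⊢
        calc _ ≤ 1 / fourthRoot (n + j + 1) ^ 3 * (1 / fourthRoot (n + j + 1) ^ 2) := by gcongr
          _ = _ := by field_simp
      have h5 : 4 * (1 / fourthRoot (n + j) - 1 / fourthRoot (n + j + 1))
          = 4 / fourthRoot (n + j) - 4 / fourthRoot (n + j + 1) := by ring
      change _ ≤ 8 / fourthRoot n - 4 / fourthRoot (n + j + 1)
      linarith
  calc _ ≤ ∑ m ∈ range (n + 1 + N), 1 / fourthRoot m ^ 3 * (1 / fourthRoot (n + m) ^ 2) :=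
        sum_le_sum_of_subset_of_nonneg (range_mono (by omega)) fun m _ _ => hnn m
    _ ≤ _ := htail N
    _ ≤ _ := sub_le_self _ (div_pos four_pos (hpos _)).le

/-! ### Row sums -/

/-- The tail estimate `∑_{k ≥ n} d_k (k+1)^{1/2} ≤ 3 L (n+1)^{-1/2}`, by summation by parts
from the growth of the partial sums of `(k+1)² d_k`. -/
lemma sum_sq_mul_sqrt_le {d : ℕ → ℝ} (hd : ∀ k, 0 ≤ d k) {L : ℝ}
    (hL : ∀ n : ℕ, ∑ k ∈ range (n + 1), ((k : ℝ) + 1) ^ 2 * d k ≤ L * ((n : ℝ) + 1)) (n N : ℕ) :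
    ∑ m ∈ range N, d (n + m) * √(((n + m : ℕ) : ℝ) + 1) ≤ 3 * L / √((n : ℝ) + 1) := by
  set S : ℕ → ℝ := fun n => ∑ k ∈ range (n + 1), ((k : ℝ) + 1) ^ 2 * d k with hS
  set r : ℕ → ℝ := fun k => √((k : ℝ) + 1) with hr
  have rpos : ∀ k, 0 < r k := fun k => by simp only [hr]; positivity
  have rsq : ∀ k, r k ^ 2 = (k : ℝ) + 1 := fun k => Real.sq_sqrt (by positivity)
  have hL0 : 0 ≤ L := by
    have h1 := hL 0
    have h2 := hd 0
    simp at h1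
    linarith
  have hterm : ∀ k, d k * r k = ((k : ℝ) + 1) ^ 2 * d k / r k ^ 3 := fun k => by
    have := rpos k
    rw [← rsq]
    field_simp
  have key : ∀ j, ∑ m ∈ range (j + 1), d (n + m) * r (n + m)
      ≤ S (n + j) / r (n + j) ^ 3 + 3 * L * (1 / r n - 1 / r (n + j)) := by
    intro j
    induction j with
    | zero =>
      simp only [zero_add, sum_range_one, add_zero, sub_self, mul_zero]
      rw [hterm]
      have := rpos n
      gcongr
      exact single_le_sum (f := fun k : ℕ => ((k : ℝ) + 1) ^ 2 * d k)
        (fun k _ => mul_nonneg (sq_nonneg _) (hd k)) (self_mem_range_succ n)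
    | succ j ih =>
      rw [sum_range_succ, hterm, ← add_assoc]
      have hx := rpos (n + j)
      have hy := rpos (n + j + 1)
      have hxy : r (n + j) ≤ r (n + j + 1) := by
        exact Real.sqrt_le_sqrt (by push_cast; linarith)
      have hSs : S (n + j + 1) = S (n + j) + (((n + j + 1 : ℕ) : ℝ) + 1) ^ 2 * d (n + j + 1) :=
        sum_range_succ _ _
      have hSL : S (n + j) ≤ L * r (n + j) ^ 2 := by rw [rsq]; exact hL _
      generalize r (n + j) = x at *
      generalize r (n + j + 1) = y at *
      have h1 : 0 ≤ 1 / x ^ 3 - 1 / y ^ 3 := by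
        rw [sub_nonneg]; gcongr
      have h2 : x ^ 2 * (1 / x ^ 3 - 1 / y ^ 3) ≤ 3 * (1 / x - 1 / y) := by
        have e : 3 * (1 / x - 1 / y) - x ^ 2 * (1 / x ^ 3 - 1 / y ^ 3)
            = (y - x) * (2 * y ^ 2 - x * y - x ^ 2) / (x * y ^ 3) := by
          field_simp; ring
        have : 0 ≤ (y - x) * (2 * y ^ 2 - x * y - x ^ 2) / (x * y ^ 3) := by
          have : 0 ≤ 2 * y ^ 2 - x * y - x ^ 2 := by nlinarith
          have : 0 ≤ y - x := sub_nonneg.2 hxy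
          positivity
        linarith
      have h3 : S (n + j) * (1 / x ^ 3 - 1 / y ^ 3) ≤ L * (3 * (1 / x - 1 / y)) :=
        calc _ ≤ L * x ^ 2 * (1 / x ^ 3 - 1 / y ^ 3) := mul_le_mul_of_nonneg_right hSL h1
          _ = L * (x ^ 2 * (1 / x ^ 3 - 1 / y ^ 3)) := by ring
          _ ≤ _ := mul_le_mul_of_nonneg_left h2 hL0
      rw [hSs]
      have e1 : S (n + j) / x ^ 3 = S (n + j) * (1 / x ^ 3 - 1 / y ^ 3) + S (n + j) / y ^ 3 := by
        ring
      have e2 : 3 * L * (1 / r n - 1 / y) = 3 * L * (1 / r n - 1 / x)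
          + L * (3 * (1 / x - 1 / y)) := by ring
      rw [add_div, e2]
      linarith
  calc _ ≤ ∑ m ∈ range (N + 1), d (n + m) * r (n + m) :=
        sum_le_sum_of_subset_of_nonneg (range_mono N.le_succ)
          fun m _ _ => mul_nonneg (hd _) (rpos _).le
    _ ≤ _ := key N
    _ ≤ L * r (n + N) ^ 2 / r (n + N) ^ 3 + 3 * L * (1 / r n - 1 / r (n + N)) := by
        have := rpos (n + N)
        gcongr
        rw [rsq]
        exact hL _
    _ = 3 * L / r n - 2 * L / r (n + N) := by
        have := rpos (n + N)
        have := rpos n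
        field_simp
        ring
    _ ≤ _ := sub_le_self _ (div_nonneg (by linarith) (rpos _).le)

lemma normX_nonneg (c : ℕ → ℂ) : 0 ≤ normX c := Real.sqrt_nonneg _

lemma avg_le_normX_sq {c : ℕ → ℂ} (hc : c ∈ X) (n : ℕ) : avg c n ≤ normX c ^ 2 := by
  have h : avg c n ≤ ⨆ n, avg c n := le_ciSup hc n
  have h0 : 0 ≤ avg c n := by unfold avg; positivity
  rwa [normX, Real.sq_sqrt (h0.trans h)]

/-- The Schur weight `(n+1)^{3/8}`. -/
noncomputable def schurWeight (n : ℕ) : ℝ := √(fourthRoot n ^ 3)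

lemma schurWeight_pos (n : ℕ) : 0 < schurWeight n :=
  Real.sqrt_pos.2 (pow_pos (fourthRoot_pos n) 3)

lemma schurWeight_sq (n : ℕ) : schurWeight n ^ 2 = fourthRoot n ^ 3 :=
  Real.sq_sqrt (pow_pos (fourthRoot_pos n) 3).le

lemma row_sum_le {c : ℕ → ℂ} (hc : c ∈ X) (N n : ℕ) :
    ∑ m ∈ range N, ‖c (n + m)‖ * (schurWeight n / schurWeight m) ≤ 5 * normX c := by
  have hK := normX_nonneg c
  have hpos := fourthRoot_pos
  have h1 : ∑ m ∈ range N, ‖c (n + m)‖ ^ 2 * fourthRoot (n + m) ^ 2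
      ≤ 3 * normX c ^ 2 / fourthRoot n ^ 2 := by
    simp only [fourthRoot_sq]
    refine sum_sq_mul_sqrt_le (d := fun k => ‖c k‖ ^ 2) (fun k => sq_nonneg _) (fun n => ?_) n N
    have h := avg_le_normX_sq hc n
    rwa [avg, div_le_iff₀ (by positivity)] at h
  have h2 : ∑ m ∈ range N, fourthRoot n ^ 3 * (1 / fourthRoot m ^ 3 * (1 / fourthRoot (n + m) ^ 2))
      ≤ 8 * fourthRoot n ^ 2 := by
    have h0 := hpos n
    rw [← mul_sum]
    calc _ ≤ fourthRoot n ^ 3 * (8 / fourthRoot n) := by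
          gcongr
          exact sum_inv_mul_inv_le n N
      _ = _ := by field_simp
  have hnn : ∀ m, 0 ≤ fourthRoot n ^ 3 * (1 / fourthRoot m ^ 3 * (1 / fourthRoot (n + m) ^ 2)) :=
    fun m => by
      have := hpos n
      have := hpos m
      have := hpos (n + m)
      positivity
  have hcs := sum_sq_le_sum_mul_sum_of_sq_le_mul (range N)
    (r := fun m => ‖c (n + m)‖ * (schurWeight n / schurWeight m))
    (f := fun m => ‖c (n + m)‖ ^ 2 * fourthRoot (n + m) ^ 2)
    (g := fun m => fourthRoot n ^ 3 * (1 / fourthRoot m ^ 3 * (1 / fourthRoot (n + m) ^ 2)))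
    (fun m _ => by positivity) (fun m _ => hnn m)
    (fun m _ => by
      have := hpos m
      have := hpos (n + m)
      rw [mul_pow, div_pow, schurWeight_sq, schurWeight_sq]
      apply le_of_eq
      field_simp)
  refine abs_le_of_sq_le_sq' ?_ (by positivity) |>.2
  have h0 := hpos n
  calc _ ≤ _ := hcs
    _ ≤ (3 * normX c ^ 2 / fourthRoot n ^ 2) * (8 * fourthRoot n ^ 2) :=
        mul_le_mul h1 h2 (sum_nonneg fun m _ => hnn m) (by positivity)
    _ = 24 * normX c ^ 2 := by field_simp; ring
    _ ≤ (5 * normX c) ^ 2 := by nlinarith [sq_nonneg (normX c)]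

/-! ### The double series and the bilinear form -/

lemma sum_norm_sq_le (a : EllTwo) (N : ℕ) : ∑ n ∈ range N, ‖a n‖ ^ 2 ≤ ‖a‖ ^ 2 := by
  have h := lp.sum_rpow_le_norm_rpow (p := 2) (by norm_num) a (range N)
  simpa using h

lemma finset_sum_le {c : ℕ → ℂ} (hc : c ∈ X) (a b : EllTwo) (s : Finset (ℕ × ℕ)) :
    ∑ p ∈ s, ‖a p.1‖ * ‖b p.2‖ * ‖c (p.1 + p.2)‖ ≤ 5 * normX c * ‖a‖ * ‖b‖ := by
  obtain ⟨N, hN⟩ : ∃ N, s ⊆ range N ×ˢ range N := by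
    refine ⟨s.sup (fun p => p.1 + p.2) + 1, fun p hp => ?_⟩
    have := le_sup (f := fun p : ℕ × ℕ => p.1 + p.2) hp
    simp only [mem_product, mem_range] at this ⊢
    omega
  refine (sum_le_sum_of_subset_of_nonneg hN fun p _ _ => by positivity).trans ?_
  exact schur_sum_le (κ := fun n m => ‖c (n + m)‖) (fun _ _ => norm_nonneg _)
    (fun n m => by rw [add_comm]) schurWeight_pos (mul_nonneg (by norm_num) (normX_nonneg c)) N
    (row_sum_le hc N) (fun n => ‖a n‖) (fun n => ‖b n‖) (norm_nonneg a) (norm_nonneg b)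
    (sum_norm_sq_le a N) (sum_norm_sq_le b N)

lemma summable_norm {c : ℕ → ℂ} (hc : c ∈ X) (a b : EllTwo) :
    Summable (fun p : ℕ × ℕ => ‖a p.1‖ * ‖b p.2‖ * ‖c (p.1 + p.2)‖) :=
  summable_of_sum_le (fun p => by positivity) (finset_sum_le hc a b)

lemma tsum_norm_le {c : ℕ → ℂ} (hc : c ∈ X) (a b : EllTwo) :
    ∑' p : ℕ × ℕ, ‖a p.1‖ * ‖b p.2‖ * ‖c (p.1 + p.2)‖ ≤ 5 * normX c * ‖a‖ * ‖b‖ :=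
  (summable_norm hc a b).tsum_le_of_sum_le (finset_sum_le hc a b)

lemma norm_term (c : ℕ → ℂ) (a b : EllTwo) (p : ℕ × ℕ) :
    ‖a p.1 * b p.2 * ((‖c (p.1 + p.2)‖ : ℝ) : ℂ)‖ = ‖a p.1‖ * ‖b p.2‖ * ‖c (p.1 + p.2)‖ := by
  simp

lemma summable_term {c : ℕ → ℂ} (hc : c ∈ X) (a b : EllTwo) :
    Summable (fun p : ℕ × ℕ => a p.1 * b p.2 * ((‖c (p.1 + p.2)‖ : ℝ) : ℂ)) :=
  Summable.of_norm (by simpa only [norm_term] using summable_norm hc a b)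

/-- The Hankel-type form `(a, b) ↦ ∑_{n,m} |c_{n+m}| a_n b_m`, for `c` in `X`. -/
noncomputable def hankelForm {c : ℕ → ℂ} (hc : c ∈ X) : EllTwo →ₗ[ℂ] EllTwo →ₗ[ℂ] ℂ :=
  LinearMap.mk₂ ℂ (fun a b => ∑' p : ℕ × ℕ, a p.1 * b p.2 * ((‖c (p.1 + p.2)‖ : ℝ) : ℂ))
    (fun a a' b => by
      rw [← (summable_term hc a b).tsum_add (summable_term hc a' b)]
      exact tsum_congr fun p => by simp only [lp.coeFn_add, Pi.add_apply]; ring)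
    (fun z a b => by
      rw [smul_eq_mul, ← tsum_mul_left]
      exact tsum_congr fun p => by simp only [lp.coeFn_smul, Pi.smul_apply, smul_eq_mul]; ring)
    (fun a b b' => by
      rw [← (summable_term hc a b).tsum_add (summable_term hc a b')]
      exact tsum_congr fun p => by simp only [lp.coeFn_add, Pi.add_apply]; ring)
    (fun z a b => by
      rw [smul_eq_mul, ← tsum_mul_left]
      exact tsum_congr fun p => by simp only [lp.coeFn_smul, Pi.smul_apply, smul_eq_mul]; ring)

lemma norm_hankelForm_le {c : ℕ → ℂ} (hc : c ∈ X) (a b : EllTwo) :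
    ‖hankelForm hc a b‖ ≤ 5 * normX c * ‖a‖ * ‖b‖ := by
  refine le_trans ?_ (tsum_norm_le hc a b)
  have h := norm_tsum_le_tsum_norm (summable_term hc a b).norm
  simp only [norm_term] at h
  exact h

/-! ### The harmonic sequence -/

lemma norm_harmonicSeq (n : ℕ) : ‖harmonicSeq n‖ = 1 / ((n : ℝ) + 1) := by
  rw [harmonicSeq, norm_div, norm_one]
  congr 1
  exact_mod_cast Complex.norm_natCast (n + 1)

lemma avg_harmonicSeq (n : ℕ) : avg harmonicSeq n = 1 := by
  have h : ∀ k : ℕ, ((k : ℝ) + 1) ^ 2 * ‖harmonicSeq k‖ ^ 2 = 1 := fun k => by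
    have : (k : ℝ) + 1 ≠ 0 := by positivity
    rw [norm_harmonicSeq]
    field_simp
  have : (n : ℝ) + 1 ≠ 0 := by positivity
  simp [avg, h, this]

lemma harmonicSeq_mem : harmonicSeq ∈ X :=
  ⟨1, by rintro _ ⟨n, rfl⟩; exact (avg_harmonicSeq n).le⟩

lemma normX_harmonicSeq : normX harmonicSeq = 1 := by
  simp [normX, avg_harmonicSeq]

end GenHilbert

theorem theorem3p3 :
    ∃ B : ℝ,
      (∀ c ∈ GenHilbert.X,
        (∀ a b : GenHilbert.EllTwo,
          Summable (fun p : ℕ × ℕ => ‖a p.1‖ * ‖b p.2‖ * ‖c (p.1 + p.2)‖) ∧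
          ∑' p : ℕ × ℕ, ‖a p.1‖ * ‖b p.2‖ * ‖c (p.1 + p.2)‖
            ≤ B * GenHilbert.normX c * ‖a‖ * ‖b‖) ∧
        ∃ T : GenHilbert.EllTwo →L[ℂ] GenHilbert.EllTwo →L[ℂ] ℂ,
          (∀ a b : GenHilbert.EllTwo,
            HasSum (fun p : ℕ × ℕ => a p.1 * b p.2 * ((‖c (p.1 + p.2)‖ : ℝ) : ℂ)) (T a b)) ∧
          ‖T‖ ≤ B * GenHilbert.normX c) ∧
      GenHilbert.harmonicSeq ∈ GenHilbert.X ∧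
      GenHilbert.normX GenHilbert.harmonicSeq = 1 ∧
      (∀ a b : GenHilbert.EllTwo,
        Summable (fun p : ℕ × ℕ => ‖a p.1‖ * ‖b p.2‖ / ((p.1 : ℝ) + (p.2 : ℝ) + 1)) ∧
        ∑' p : ℕ × ℕ, ‖a p.1‖ * ‖b p.2‖ / ((p.1 : ℝ) + (p.2 : ℝ) + 1)
          ≤ B * ‖a‖ * ‖b‖) := by
  refine ⟨5, fun c hc => ⟨fun a b => ⟨GenHilbert.summable_norm hc a b,
    GenHilbert.tsum_norm_le hc a b⟩, ?_⟩, GenHilbert.harmonicSeq_mem,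
    GenHilbert.normX_harmonicSeq, fun a b => ?_⟩
  · refine ⟨(GenHilbert.hankelForm hc).mkContinuous₂ (5 * GenHilbert.normX c)
      (GenHilbert.norm_hankelForm_le hc), fun a b => (GenHilbert.summable_term hc a b).hasSum, ?_⟩
    exact LinearMap.mkContinuous₂_norm_le _
      (mul_nonneg (by norm_num) (GenHilbert.normX_nonneg c)) _
  · have e : (fun p : ℕ × ℕ => ‖a p.1‖ * ‖b p.2‖ / ((p.1 : ℝ) + (p.2 : ℝ) + 1))
        = fun p : ℕ × ℕ => ‖a p.1‖ * ‖b p.2‖ * ‖GenHilbert.harmonicSeq (p.1 + p.2)‖ := by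
      funext p
      rw [GenHilbert.norm_harmonicSeq, mul_one_div, Nat.cast_add]
    have h := GenHilbert.tsum_norm_le GenHilbert.harmonicSeq_mem a b
    rw [GenHilbert.normX_harmonicSeq, mul_one] at h
    rw [e]
    exact ⟨GenHilbert.summable_norm GenHilbert.harmonicSeq_mem a b, h⟩
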